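/- A (query) search problem is a relation $R \subseteq \{0,1\}^n \times \mathcal{O}$, the bits of whose input $x \in \{0,1\}^n$ are accessed by queries. For search problems $R \subseteq \{0,1\}^n \times \mathcal{O}$ and $S \subseteq \{0,1\}^m \times \mathcal{O}'$, an $S$-formulation of $R$ consists of functions $f_i : \{0,1\}^n \to \{0,1\}$ ($i \in [m]$) and $g_o : \{0,1\}^n \to \mathcal{O}$ ($o \in \mathcal{O}'$) such that $(f(x), o) \in S$ implies $(x, g_o(x)) \in R$, where $f(x) = (f_1(x), \dots, f_m(x))$. Its complexity is $\log_2 m + d$ (with $\log_2 m$ rounded up), where $d$ is the maximum, over all the functions $f_i$ and $g_o$, of the minimum depth of a decision tree, querying bits of $x$, that computes the function. The complexity of reducing $R$ to a family $\mathcal{S}$ of search problems is the minimum complexity of an $S$-formulation of $R$ over all $S \in \mathcal{S}$. For families, $\mathcal{R} \leq_{dt} \mathcal{S}$ means that the complexity of reducing each member of $\mathcal{R}$, with $n$ input bits, to $\mathcal{S}$ is at most polylogarithmic in $n$. Lossy-Code is the family, indexed by integers $M \ge 1$, of the problems: given functions $f : [M] \to [2M]$ and $g : [2M] \to [M]$,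 find $x \in [2M]$ such that $f(g(x)) \ne x$. For a constant $c > 1$, $c$-AMGM-LC is the family, indexed by integers $N \ge 1$, of the problems: let $V = [2N]$ and $P = [\lceil cN^2\rceil]$; given a colouring $C : V \to \{0,1\}$ and maps $F : P \to V \times V$ and $G : V \times V \to P$, find $x \in P$ such that $G(F(x)) \ne x$ or $F(x) \notin C^{-1}(0) \times C^{-1}(1)$. In both families functions are given by the bits of their values, an element of $[K]$ being written in binary with $\lceil \log_2 K\rceil$ bits (a block of bits whose value is at least $K$ is read modulo $K$). **Theorem.** For every constant $c > 1$, $c$-AMGM-LC $\leq_{dt}$ Lossy-Code. Moreover, the complexity of reducing the $c$-AMGM-LC problem with parameter $N$ to Lossy-Code is $\mathrm{polylog}(N)$: there is a constant $K$, depending only on $c$, such that for every $N \ge 1$ it is at most $K (\lfloor\log_2 N\rfloor + 1)^K$. -/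

import Mathlib

/-- A decision tree that queries the bits `x i` (`i : ι`) of an input `x : ι → Bool` and whose
leaves are labelled by elements of `α`. -/
inductive DecisionTree (ι α : Type) : Type
  | leaf (a : α) : DecisionTree ι α
  | query (i : ι) (t₀ t₁ : DecisionTree ι α) : DecisionTree ι α

namespace DecisionTree

/-- The label of the leaf reached on input `x`. -/
def eval {ι α : Type} : DecisionTree ι α → (ι → Bool) → α
  | leaf a, _ => a
  | query i t₀ t₁, x => if x i then t₁.eval x else t₀.eval x

/-- The depth: the largest number of queries on a root-to-leaf path. -/
def depth {ι α : Type} : DecisionTree ι α → ℕ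
  | leaf _ => 0
  | query _ t₀ t₁ => max t₀.depth t₁.depth + 1

end DecisionTree

/-- Some decision tree of depth at most `d` computes `h`; that is, the minimum depth of a
decision tree computing `h` is at most `d`. -/
def DTDepthLE {ι α : Type} (h : (ι → Bool) → α) (d : ℕ) : Prop :=
  ∃ T : DecisionTree ι α, T.depth ≤ d ∧ ∀ x, T.eval x = h x

/-- A (single) query search problem: a relation `Rel ⊆ {0,1}^n × Out`, where the `n` input bits
are indexed by the finite type `Idx`. -/
structure SearchProblem : Type 1 where
  Idx : Type
  [fintypeIdx : Fintype Idx]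
  Out : Type
  Rel : (Idx → Bool) → Out → Prop

attribute [instance] SearchProblem.fintypeIdx

namespace SearchProblem

/-- The number of input bits. -/
def bits (R : SearchProblem) : ℕ := Fintype.card R.Idx

/-- An `S`-formulation of `R`: a function computing each input bit of the instance of `S`, and for
every candidate solution `o` of `S` a function computing a candidate solution of `R`, such that
solutions of the constructed instance of `S` are sent to solutions of the given instance of `R`. -/
structure Formulation (R S : SearchProblem) where
  f : S.Idx → (R.Idx → Bool) → Bool
  g : S.Out → (R.Idx → Bool) → R.Out
  correct : ∀ x o, S.Rel (fun i => f i x) o → R.Rel x (g o x)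

/-- All functions of the formulation have decision-tree depth at most `d`. -/
def Formulation.DepthLE {R S : SearchProblem} (φ : Formulation R S) (d : ℕ) : Prop :=
  (∀ i, DTDepthLE (φ.f i) d) ∧ (∀ o, DTDepthLE (φ.g o) d)

/-- The complexity `log m + depth` of the formulation is at most `b`, where `m` is the number of
input bits of `S` (with the logarithm rounded up). -/
def Formulation.ComplexityLE {R S : SearchProblem} (φ : Formulation R S) (b : ℕ) : Prop :=
  ∃ d : ℕ, φ.DepthLE d ∧ Nat.clog 2 S.bits + d ≤ b

/-- The complexity of reducing `R` to the family `S` (the minimum over all members of the family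
and all formulations) is at most `b`. -/
def ReductionComplexityLE {J : Type} (R : SearchProblem) (S : J → SearchProblem) (b : ℕ) : Prop :=
  ∃ (j : J) (φ : Formulation R (S j)), φ.ComplexityLE b

/-- `R ≤_dt S`: the complexity of reducing a member of `R` with `n` input bits to `S` is
polylogarithmic in `n`. -/
def DTReducible {I J : Type} (R : I → SearchProblem) (S : J → SearchProblem) : Prop :=
  ∃ K : ℕ, ∀ i, ReductionComplexityLE (R i) S (K * (Nat.log 2 (R i).bits + 1) ^ K)

end SearchProblem

/-- The number `⌈log₂ M⌉` of bits used to write an element of `[M]`. -/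
def codeLength (M : ℕ) : ℕ := Nat.clog 2 M

/-- The element of `[M]` written in a block of bits: its binary value, reduced modulo `M` (which
only matters for blocks whose value is not less than `M`). -/
def decode (M : ℕ) [NeZero M] (b : Fin (codeLength M) → Bool) : Fin M :=
  Fin.ofNat M (Nat.ofBits b)

/-- `x` is a solution of the Lossy-Code instance `f : A → B`, `g : B → A`. -/
def IsLossyCodeSolution {A B : Type} (f : A → B) (g : B → A) (x : B) : Prop :=
  f (g x) ≠ x

/-- Lossy-Code with `f : [M] → [2M]` and `g : [2M] → [M]`, both given by the bits of their
values. -/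
def LossyCode (M : ℕ+) : SearchProblem where
  Idx := (Fin (M : ℕ) × Fin (codeLength (2 * M))) ⊕
    (Fin (2 * (M : ℕ)) × Fin (codeLength M))
  Out := Fin (2 * (M : ℕ))
  Rel x := IsLossyCodeSolution
    (fun y : Fin (M : ℕ) => decode (2 * M) fun j => x (.inl (y, j)))
    (fun z : Fin (2 * (M : ℕ)) => decode M fun j => x (.inr (z, j)))

/-- `x` is a solution of the AM-GM Lossy-Code instance given by the colouring `C` (the colours 0
and 1 being `false` and `true`) and the maps `F`, `G`: either `G (F x) ≠ x`, or `F x` is not in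
`C⁻¹(0) × C⁻¹(1)`. -/
def IsAMGMSolution {V P : Type} (C : V → Bool) (F : P → V × V) (G : V × V → P) (x : P) : Prop :=
  G (F x) ≠ x ∨ F x ∉ (C ⁻¹' {false}) ×ˢ (C ⁻¹' {true})

/-- The number `⌈c N²⌉` of pigeons. -/
noncomputable def pigeons (c : ℝ) (hc : 1 < c) (N : ℕ+) : ℕ+ :=
  ⟨⌈c * (N : ℝ) ^ 2⌉₊, Nat.ceil_pos.mpr (by have := N.pos; positivity)⟩

/-- `c`-AM-GM-Lossy-Code with `V = [2N]` and `P = [⌈c N²⌉]`. The input consists of the colours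
`C v`, the bits of the two components of `F p`, and the bits of `G (u, v)`. -/
noncomputable def AMGMLossyCode (c : ℝ) (hc : 1 < c) (N : ℕ+) : SearchProblem where
  Idx := Fin (2 * (N : ℕ)) ⊕
    (Fin (pigeons c hc N : ℕ) × Fin 2 × Fin (codeLength (2 * N))) ⊕
    ((Fin (2 * (N : ℕ)) × Fin (2 * (N : ℕ))) × Fin (codeLength (pigeons c hc N)))
  Out := Fin (pigeons c hc N : ℕ)
  Rel x := IsAMGMSolution
    (fun v : Fin (2 * (N : ℕ)) => x (.inl v))
    (fun p : Fin (pigeons c hc N : ℕ) =>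
      (decode (2 * N) fun j => x (.inr (.inl (p, 0, j))),
        decode (2 * N) fun j => x (.inr (.inl (p, 1, j)))))
    (fun e : Fin (2 * (N : ℕ)) × Fin (2 * (N : ℕ)) =>
      decode (pigeons c hc N) fun j => x (.inr (.inr (e, j))))

/-! Without failures, `F` would embed `P` into pairs with first vertex coloured 0 and second
coloured 1, and by AM-GM there are at most `N ^ 2` of these. To turn this into a shrinking map
without counting colour classes, take `k` pigeons together with a balanced pattern `s` of `2k`
positions. Write the 1-coloured endpoints inside `s` and the 0-coloured ones outside, giving a word
in `V ^ (2k)`. The colours of the word reveal `s`, hence the edges, and `G` returns the pigeons; any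
failure exposes a bad pigeon (`colourSet_word`, `pair_word`). There are at least `4 ^ k / (2k) * (c
* N ^ 2) ^ k` messages and `(2N) ^ (2k)` words, so `4k ≤ c ^ k` gives the factor 2 that Lossy-Code
needs (`two_mul_le_centralBinom_mul_pigeons`). As `k` depends only on `c`, depth and `log M` are
`O(log N)`. -/

namespace DTDepthLE

/-! ### Composition of decision trees. -/

variable {ι α β : Type}

theorem mono {h : (ι → Bool) → α} {d e : ℕ} (hd : DTDepthLE h d) (hde : d ≤ e) :
    DTDepthLE h e := by
  obtain ⟨T, hT, hx⟩ := hd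
  exact ⟨T, hT.trans hde, hx⟩

theorem const (a : α) : DTDepthLE (fun _ : ι → Bool => a) 0 :=
  ⟨.leaf a, le_rfl, fun _ => rfl⟩

theorem proj (i : ι) : DTDepthLE (fun x : ι → Bool => x i) 1 :=
  ⟨.query i (.leaf false) (.leaf true), by simp [DecisionTree.depth], fun x => by
    cases h : x i <;> simp [DecisionTree.eval, h]⟩

/-- Running a decision tree whose choice depends on the output of another one. -/
theorem bind {h : (ι → Bool) → α} {k : α → (ι → Bool) → β} {d e : ℕ}
    (hh : DTDepthLE h d) (hk : ∀ a, DTDepthLE (k a) e) :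
    DTDepthLE (fun x => k (h x) x) (d + e) := by
  obtain ⟨T, hT, hx⟩ := hh
  suffices H : ∀ (T : DecisionTree ι α), ∃ T' : DecisionTree ι β,
      T'.depth ≤ T.depth + e ∧ ∀ x, T'.eval x = k (T.eval x) x by
    obtain ⟨T', hd, he⟩ := H T
    exact ⟨T', by omega, fun x => by rw [he, hx]⟩
  intro T
  induction T with
  | leaf a =>
    obtain ⟨T', hd, he⟩ := hk a
    exact ⟨T', by omega, he⟩
  | query i t₀ t₁ ih₀ ih₁ =>
    obtain ⟨s₀, hd₀, he₀⟩ := ih₀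
    obtain ⟨s₁, hd₁, he₁⟩ := ih₁
    refine ⟨.query i s₀ s₁, ?_, fun x => ?_⟩
    · simp only [DecisionTree.depth]
      omega
    · cases h : x i <;> simp [DecisionTree.eval, h, he₀, he₁]

theorem map {h : (ι → Bool) → α} {d : ℕ} (hh : DTDepthLE h d) (k : α → β) :
    DTDepthLE (fun x => k (h x)) d :=
  bind (k := fun a _ => k a) hh fun a => const (k a)

theorem pi {n d : ℕ} {h : Fin n → (ι → Bool) → α} (hh : ∀ i, DTDepthLE (h i) d) :
    DTDepthLE (fun x i => h i x) (n * d) := by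
  induction n with
  | zero =>
    have hc : (fun (x : ι → Bool) (i : Fin 0) => h i x) = fun _ => Fin.elim0 := by
      funext x i
      exact i.elim0
    rw [hc]
    exact (const _).mono (Nat.zero_le _)
  | succ n ih =>
    have hb := bind (k := fun a x => (Fin.cons a (fun i : Fin n => h i.succ x) : Fin (n + 1) → α))
      (hh 0) fun a => (ih fun i => hh i.succ).map fun t => (Fin.cons a t : Fin (n + 1) → α)
    have hc : (fun (x : ι → Bool) (i : Fin (n + 1)) => h i x) =
        fun x => (Fin.cons (h 0 x) (fun i : Fin n => h i.succ x) : Fin (n + 1) → α) := by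
      funext x i
      refine Fin.cases rfl (fun j => rfl) i
    rw [hc]
    exact hb.mono (by rw [Nat.succ_mul, Nat.add_comm])

theorem decode {M : ℕ} [NeZero M] (q : Fin (codeLength M) → ι) :
    DTDepthLE (fun x : ι → Bool => _root_.decode M fun j => x (q j)) (codeLength M) :=
  ((pi (h := fun j x => x (q j)) fun j => proj (q j)).map (_root_.decode M)).mono
    (Nat.mul_one _).le

end DTDepthLE

/-- The binary expansion of an element of `[M]`. -/
def encodeBits {M : ℕ} (a : Fin M) (j : Fin (codeLength M)) : Bool :=
  (a : ℕ).testBit j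

theorem decode_encodeBits {M : ℕ} [NeZero M] (a : Fin M) : decode M (encodeBits a) = a := by
  have h : Nat.ofBits (encodeBits a) = a := by
    have h' : encodeBits a = fun j : Fin (codeLength M) => (a : ℕ).testBit j := rfl
    rw [h', Nat.ofBits_testBit]
    exact Nat.mod_eq_of_lt (a.isLt.trans_le (Nat.le_pow_clog one_lt_two M))
  rw [decode, h]
  exact Fin.ofNat_val_eq_self a

/-! ### From abstract lossy codes to Lossy-Code. -/

namespace SearchProblem

/-- A lossy compression of `X` into `Y`, with `|X| ≥ 2 |Y|`, whose failures yield solutions of `R`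
gives a formulation of `R` as Lossy-Code. -/
theorem exists_formulation_lossyCode (R : SearchProblem) {X Y : Type} [Fintype X] [Fintype Y]
    [Nonempty X] (M : ℕ+) (hY : Fintype.card Y = M) (hX : 2 * (M : ℕ) ≤ Fintype.card X)
    (enc : X → (R.Idx → Bool) → Y) (dec : Y → (R.Idx → Bool) → X)
    (sol : X → (R.Idx → Bool) → R.Out) (d : ℕ)
    (henc : ∀ a, DTDepthLE (enc a) d) (hdec : ∀ y, DTDepthLE (dec y) d)
    (hsol : ∀ a, DTDepthLE (sol a) d)
    (correct : ∀ x a, dec (enc a x) x ≠ a → R.Rel x (sol a x)) :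
    ∃ φ : Formulation R (LossyCode M), φ.DepthLE d := by
  classical
  let e : Y ≃ Fin (M : ℕ) := Fintype.equivFinOfCardEq hY
  obtain ⟨i⟩ : Nonempty (Fin (2 * (M : ℕ)) ↪ X) :=
    Function.Embedding.nonempty_of_card_le (by simpa using hX)
  have : Nonempty (Fin (2 * (M : ℕ))) := ⟨⟨0, by have := M.pos; omega⟩⟩
  -- Only `2M` of the messages are used; decoded values outside the range of `i` get an arbitrary
  -- index.
  let r : X → Fin (2 * (M : ℕ)) := Function.invFun i
  have hr : ∀ z, r (i z) = z := Function.leftInverse_invFun i.injective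
  let φf : (LossyCode M).Idx → (R.Idx → Bool) → Bool := fun q x =>
    match q with
    | .inl (y, j) => encodeBits (r (dec (e.symm y) x)) j
    | .inr (z, j) => encodeBits (e (enc (i z) x)) j
  refine ⟨⟨φf, fun z x => sol (i z) x, fun x z hz => correct x (i z) fun h => hz ?_⟩, ?_, ?_⟩
  · have hg : (decode (M : ℕ) fun j => φf (.inr (z, j)) x) = e (enc (i z) x) :=
      decode_encodeBits _
    have hf : ∀ y : Fin (M : ℕ), (decode (2 * (M : ℕ)) fun j => φf (.inl (y, j)) x) =
      r (dec (e.symm y) x) := fun y => decode_encodeBits _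
    change (decode (2 * (M : ℕ)) fun j => φf (.inl (decode (M : ℕ) fun j => φf (.inr (z, j)) x, j)) x)
      = z
    rw [hf, hg, Equiv.symm_apply_apply, h]
    exact hr z
  · rintro (⟨y, j⟩ | ⟨z, j⟩)
    · exact (hdec (e.symm y)).map fun a => encodeBits (r a) j
    · exact (henc (i z)).map fun b => encodeBits (e b) j
  · exact fun z => hsol (i z)

end SearchProblem

/-! ### Balanced patterns and words. -/

/-- The positions of a word of length `2k` are paired up compatibly with a balanced pattern. -/
theorem exists_equiv_of_card_eq {k : ℕ} (s : Finset (Fin (2 * k))) (hs : s.card = k) :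
    ∃ e : Bool × Fin k ≃ Fin (2 * k), ∀ q, e q ∈ s ↔ q.1 = true := by
  have h₁ : Fintype.card {i // i ∈ s} = k := by simpa using hs
  have h₀ : Fintype.card {i // ¬ i ∈ s} = k := by
    rw [Fintype.card_subtype_compl, h₁, Fintype.card_fin]
    omega
  let e₁ := (Fintype.equivFinOfCardEq h₁).symm
  let e₀ := (Fintype.equivFinOfCardEq h₀).symm
  -- The swap is needed because `false` goes to the left summand, whereas `Equiv.sumCompl` has the
  -- members of `s` on the left.
  refine ⟨(Equiv.boolProdEquivSum (Fin k)).trans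
    ((Equiv.sumCongr e₀ e₁).trans ((Equiv.sumComm _ _).trans (Equiv.sumCompl (· ∈ s)))), ?_⟩
  rintro ⟨_ | _, j⟩
  · simpa using (e₀ j).2
  · simp

/-- Balanced patterns of length `2k`. -/
abbrev BalancedPattern (k : ℕ) : Type := {s : Finset (Fin (2 * k)) // s.card = k}

namespace BalancedPattern

theorem card_eq (k : ℕ) : Fintype.card (BalancedPattern k) = k.centralBinom := by
  rw [Fintype.card_finset_len, Fintype.card_fin, Nat.centralBinom]

/-- A pairing of the positions outside and inside of a balanced pattern. -/
noncomputable def pairing {k : ℕ} (s : BalancedPattern k) : Bool × Fin k ≃ Fin (2 * k) :=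
  (exists_equiv_of_card_eq s.1 s.2).choose

theorem pairing_mem {k : ℕ} (s : BalancedPattern k) (q : Bool × Fin k) :
    s.pairing q ∈ s.1 ↔ q.1 = true :=
  (exists_equiv_of_card_eq s.1 s.2).choose_spec q

section Code

variable {V P : Type} {k : ℕ}

/-- The word in which the endpoints of the edges `E j` are arranged according to a pattern. -/
noncomputable def word (s : BalancedPattern k) (E : Fin k → V × V) (i : Fin (2 * k)) : V :=
  bif (s.pairing.symm i).1 then (E (s.pairing.symm i).2).2 else (E (s.pairing.symm i).2).1

/-- The set of positions of a word with colour 1. -/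
def colourSet (χ : Fin (2 * k) → Bool) : Finset (Fin (2 * k)) := {i | χ i = true}

theorem mem_colourSet (χ : Fin (2 * k) → Bool) (i : Fin (2 * k)) :
    i ∈ colourSet χ ↔ χ i = true := by
  simp [colourSet]

/-- This lets the decoder recover the pattern, and with it the pairing, from colours alone. -/
theorem colourSet_word (C : V → Bool) (s : BalancedPattern k) (E : Fin k → V × V)
    (h₀ : ∀ j, C (E j).1 = false) (h₁ : ∀ j, C (E j).2 = true) :
    colourSet (fun i => C (s.word E i)) = s.1 := by
  ext i
  obtain ⟨⟨b, j⟩, rfl⟩ := s.pairing.surjective i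
  rw [pairing_mem, mem_colourSet]
  cases b <;> simp [word, h₀, h₁]

theorem pair_word (s : BalancedPattern k) (E : Fin k → V × V) (j : Fin k) :
    (s.word E (s.pairing (false, j)), s.word E (s.pairing (true, j))) = E j := by
  simp [word]

end Code

end BalancedPattern

/-! ### Counting and size estimates. -/

/-- In `4k`, a factor `2k` pays for restricting to balanced patterns and a factor 2 for the stretch
of Lossy-Code. -/
theorem exists_four_mul_le_pow {c : ℝ} (hc : 1 < c) : ∃ k : ℕ, 0 < k ∧ 4 * (k : ℝ) ≤ c ^ k := by
  have h := tendsto_pow_const_div_const_pow_of_one_lt 1 hc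
  have h' := (h.eventually (gt_mem_nhds (show (0 : ℝ) < 1 / 4 by norm_num))).and
    (Filter.eventually_gt_atTop 0)
  obtain ⟨k, hk, hk0⟩ := h'.exists
  refine ⟨k, hk0, ?_⟩
  rw [div_lt_iff₀ (by positivity), pow_one] at hk
  linarith

theorem two_mul_le_centralBinom_mul_pigeons {c : ℝ} (hc : 1 < c) {k : ℕ} (hk : 0 < k)
    (hck : 4 * (k : ℝ) ≤ c ^ k) (N : ℕ+) :
    2 * (2 * (N : ℕ)) ^ (2 * k) ≤ k.centralBinom * (pigeons c hc N : ℕ) ^ k := by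
  have hp : c * (N : ℝ) ^ 2 ≤ ((pigeons c hc N : ℕ) : ℝ) := Nat.le_ceil _
  have hb : ((4 : ℝ) ^ k) ≤ 2 * k * (k.centralBinom : ℝ) := by
    exact_mod_cast Nat.four_pow_le_two_mul_self_mul_centralBinom k hk
  have hk' : (0 : ℝ) < k := by exact_mod_cast hk
  have hpk : 4 * (k : ℝ) * (N : ℝ) ^ (2 * k) ≤ ((pigeons c hc N : ℕ) : ℝ) ^ k :=
    calc 4 * (k : ℝ) * (N : ℝ) ^ (2 * k) ≤ c ^ k * (N : ℝ) ^ (2 * k) := by gcongr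
      _ = (c * (N : ℝ) ^ 2) ^ k := by rw [mul_pow, pow_mul]
      _ ≤ _ := by gcongr
  have key : (2 * (2 * (N : ℝ)) ^ (2 * k)) ≤
      (k.centralBinom : ℝ) * ((pigeons c hc N : ℕ) : ℝ) ^ k :=
    calc (2 * (2 * (N : ℝ)) ^ (2 * k)) = 2 * (4 ^ k * (N : ℝ) ^ (2 * k)) := by
          rw [mul_pow, pow_mul 2 2 k]; norm_num
      _ ≤ 2 * (2 * k * (k.centralBinom : ℝ) * (N : ℝ) ^ (2 * k)) := by gcongr
      _ = (k.centralBinom : ℝ) * (4 * (k : ℝ) * (N : ℝ) ^ (2 * k)) := by ring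
      _ ≤ _ := by gcongr
  exact_mod_cast key

theorem codeLength_le {n b : ℕ} (h : n ≤ 2 ^ b) : codeLength n ≤ b :=
  Nat.clog_le_of_le_pow h

theorem pigeons_le (c : ℝ) (hc : 1 < c) (N : ℕ+) :
    (pigeons c hc N : ℕ) ≤ ⌈c⌉₊ * (N : ℕ) ^ 2 := by
  refine Nat.ceil_le.mpr ?_
  push_cast
  gcongr
  exact Nat.le_ceil c

theorem clog_bits_lossyCode_le (M : ℕ+) {b : ℕ} (h : (M : ℕ) ≤ 2 ^ b) :
    Nat.clog 2 (LossyCode M).bits ≤ 2 * b + 2 := by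
  refine Nat.clog_le_of_le_pow ?_
  have hbits : (LossyCode M).bits =
      M * codeLength (2 * M) + 2 * M * codeLength M := by
    change Fintype.card ((Fin (M : ℕ) × Fin (codeLength (2 * M))) ⊕
      (Fin (2 * (M : ℕ)) × Fin (codeLength M))) = _
    simp
  have h₁ : codeLength (2 * M) ≤ 2 * M := codeLength_le Nat.lt_two_pow_self.le
  have h₂ : codeLength M ≤ M := codeLength_le Nat.lt_two_pow_self.le
  calc (LossyCode M).bits ≤ M * (2 * M) + 2 * M * M := by rw [hbits]; gcongr
    _ = 4 * (M * M) := by ring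
    _ ≤ 4 * (2 ^ b * 2 ^ b) := by gcongr
    _ = 2 ^ (2 * b + 2) := by ring

/-! ### The reduction and its complexity. -/

open SearchProblem in
theorem exists_formulation_amgmLossyCode (c : ℝ) (hc : 1 < c) (k : ℕ) (hk : 0 < k)
    (hck : 4 * (k : ℝ) ≤ c ^ k) (N M : ℕ+) (hM : (M : ℕ) = (2 * (N : ℕ)) ^ (2 * k)) :
    ∃ φ : Formulation (AMGMLossyCode c hc N) (LossyCode M),
      φ.DepthLE (k * (2 * codeLength (2 * N) + codeLength (pigeons c hc N) + 2)) := by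
  classical
  let V := Fin (2 * (N : ℕ))
  let P := Fin (pigeons c hc N : ℕ)
  let ι := (AMGMLossyCode c hc N).Idx
  let C : V → (ι → Bool) → Bool := fun v x => x (.inl v)
  let F₀ : P → (ι → Bool) → V := fun p x => decode (2 * N) fun j => x (.inr (.inl (p, 0, j)))
  let F₁ : P → (ι → Bool) → V := fun p x => decode (2 * N) fun j => x (.inr (.inl (p, 1, j)))
  let G : V × V → (ι → Bool) → P := fun e x =>
    decode (pigeons c hc N) fun j => x (.inr (.inr (e, j)))
  have hC : ∀ v, DTDepthLE (C v) 1 := fun v => .proj _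
  have hF₀ : ∀ p, DTDepthLE (F₀ p) (codeLength (2 * N)) := fun p => .decode _
  have hF₁ : ∀ p, DTDepthLE (F₁ p) (codeLength (2 * N)) := fun p => .decode _
  have hG : ∀ e, DTDepthLE (G e) (codeLength (pigeons c hc N)) := fun e => .decode _
  let isSol : P → (ι → Bool) → Prop := fun p x =>
    IsAMGMSolution (fun v => C v x) (fun p => (F₀ p x, F₁ p x)) (fun e => G e x) p
  have hisSol : ∀ p, DTDepthLE (isSol p)
      (2 * codeLength (2 * N) + codeLength (pigeons c hc N) + 2) := by
    intro p
    -- Checking one pigeon costs both endpoints, one value of `G` and two colours.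
    have h := (hF₀ p).bind (k := fun u x => G (u, F₁ p x) x ≠ p ∨
        (u, F₁ p x) ∉ ((fun v => C v x) ⁻¹' {false}) ×ˢ ((fun v => C v x) ⁻¹' {true}))
      fun u => (hF₁ p).bind (k := fun v x => G (u, v) x ≠ p ∨
        (u, v) ∉ ((fun v => C v x) ⁻¹' {false}) ×ˢ ((fun v => C v x) ⁻¹' {true}))
      fun v => (hG (u, v)).bind (k := fun q x => q ≠ p ∨ ¬ (C u x = false ∧ C v x = true))
      fun q => (hC u).bind (k := fun b x => q ≠ p ∨ ¬ (b = false ∧ C v x = true))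
      fun b => (hC v).map fun b' => q ≠ p ∨ ¬ (b = false ∧ b' = true)
    exact h.mono (by omega)
  let X := BalancedPattern k × (Fin k → P)
  let Y := Fin (2 * k) → V
  have hXcard : Fintype.card X = k.centralBinom * (pigeons c hc N : ℕ) ^ k := by
    rw [Fintype.card_prod, BalancedPattern.card_eq, Fintype.card_fun, Fintype.card_fin,
      Fintype.card_fin]
  have hX : 2 * (M : ℕ) ≤ Fintype.card X := by
    rw [hXcard, hM]
    exact two_mul_le_centralBinom_mul_pigeons hc hk hck N
  have hne : Nonempty X := Fintype.card_pos_iff.mp (by have := M.pos; omega)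
  let enc : X → (ι → Bool) → Y := fun a x => a.1.word fun j => (F₀ (a.2 j) x, F₁ (a.2 j) x)
  -- A word with unbalanced colours never encodes a message of good pigeons, so its decoding is
  -- arbitrary.
  let dec : Y → (ι → Bool) → X := fun w x =>
    if h : (BalancedPattern.colourSet fun i => C (w i) x).card = k then
      (⟨_, h⟩, fun j => G (w (BalancedPattern.pairing ⟨_, h⟩ (false, j)),
        w (BalancedPattern.pairing ⟨_, h⟩ (true, j))) x)
    else hne.some
  -- The fallback pigeon is never reached when decoding fails.
  let sol : X → (ι → Bool) → P := fun a x =>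
    if h : ∃ j, isSol (a.2 j) x then a.2 h.choose else a.2 ⟨0, hk⟩
  refine exists_formulation_lossyCode (AMGMLossyCode c hc N) (X := X) (Y := Y) M ?_ hX enc dec sol _
    ?_ ?_ ?_ ?_
  · rw [Fintype.card_fun, Fintype.card_fin, Fintype.card_fin, hM]
  · intro a
    have h := DTDepthLE.pi (h := fun j x => (F₀ (a.2 j) x, F₁ (a.2 j) x)) fun j =>
      (hF₀ (a.2 j)).bind (k := fun u x => (u, F₁ (a.2 j) x)) fun u =>
        (hF₁ (a.2 j)).map fun v => (u, v)
    exact (h.map fun E => a.1.word E).mono (Nat.mul_le_mul_left k (by omega))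
  · intro w
    -- As `w` is fixed, the `2k` colours determine which `k` values of `G` to read.
    have h := (DTDepthLE.pi (h := fun i x => C (w i) x) fun i => hC (w i)).bind
      (e := k * codeLength (pigeons c hc N))
      (k := fun χ x => if h : (BalancedPattern.colourSet χ).card = k then
        ((⟨_, h⟩, fun j => G (w (BalancedPattern.pairing ⟨_, h⟩ (false, j)),
          w (BalancedPattern.pairing ⟨_, h⟩ (true, j))) x) : X)
        else hne.some) fun χ => by
        by_cases h : (BalancedPattern.colourSet χ).card = k
        · simp only [h, dite_true]
          exact (DTDepthLE.pi fun j => hG _).map fun p => ((⟨_, h⟩, p) : X)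
        · simp only [h, dite_false]
          exact (DTDepthLE.const _).mono (Nat.zero_le _)
    refine h.mono ?_
    have : 0 ≤ k * codeLength (2 * N) := Nat.zero_le _
    nlinarith
  · intro a
    -- The choice of index depends on `x` only through the `k` truth values, so it costs no further
    -- queries.
    exact (DTDepthLE.pi (h := fun j x => isSol (a.2 j) x) fun j => hisSol (a.2 j)).map fun b =>
      if h : ∃ j, b j then a.2 h.choose else a.2 ⟨0, hk⟩
  · intro x a hxa
    have hex : ∃ j, isSol (a.2 j) x := by
      by_contra! hno
      refine hxa ?_
      have hgood : ∀ j, G (F₀ (a.2 j) x, F₁ (a.2 j) x) x = a.2 j ∧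
          C (F₀ (a.2 j) x) x = false ∧ C (F₁ (a.2 j) x) x = true := by
        intro j
        have := hno j
        simp only [isSol, IsAMGMSolution, not_or, not_not] at this
        exact this
      obtain ⟨s, p⟩ := a
      have hs := BalancedPattern.colourSet_word (fun v => C v x) s
        (fun j => (F₀ (p j) x, F₁ (p j) x)) (fun j => (hgood j).2.1) fun j => (hgood j).2.2
      have hcard : (BalancedPattern.colourSet fun i => C (enc (s, p) x i) x).card = k :=
        (congrArg Finset.card hs).trans s.2
      have hs' : (⟨_, hcard⟩ : BalancedPattern k) = s := Subtype.ext hs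
      simp only [dec]
      rw [dif_pos hcard, hs']
      refine Prod.ext rfl (funext fun j => ?_)
      change G (s.word _ (s.pairing (false, j)), s.word _ (s.pairing (true, j))) x = p j
      rw [BalancedPattern.pair_word]
      exact (hgood j).1
    change isSol (sol a x) x
    simp only [sol]
    rw [dif_pos hex]
    exact hex.choose_spec

open SearchProblem in
theorem amgmLossyCode_reductionComplexityLE (c : ℝ) (hc : 1 < c) :
    ∃ K : ℕ, ∀ N : ℕ+, ReductionComplexityLE (AMGMLossyCode c hc N) LossyCode
      (K * (Nat.log 2 (N : ℕ) + 1) ^ K) := by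
  obtain ⟨k, hk, hck⟩ := exists_four_mul_le_pow hc
  -- The bound is linear in `log N`; the constant serves as coefficient, and as exponent any number
  -- at least 1 would do.
  refine ⟨16 * k + k * ⌈c⌉₊ + 2, fun N => ?_⟩
  let M : ℕ+ := ⟨(2 * (N : ℕ)) ^ (2 * k), by have := N.pos; positivity⟩
  obtain ⟨φ, hφ⟩ := exists_formulation_amgmLossyCode c hc k hk hck N M rfl
  refine ⟨M, φ, _, hφ, ?_⟩
  obtain ⟨L, hL⟩ : ∃ L, L = Nat.log 2 (N : ℕ) + 1 := ⟨_, rfl⟩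
  rw [← hL]
  have hL1 : 1 ≤ L := by omega
  have hN : (N : ℕ) ≤ 2 ^ L := hL ▸ (Nat.lt_pow_succ_log_self one_lt_two _).le
  have h2N : 2 * (N : ℕ) ≤ 2 ^ (L + 1) := by rw [pow_succ]; omega
  have hV : codeLength (2 * N) ≤ L + 1 := codeLength_le h2N
  have hP : codeLength (pigeons c hc N) ≤ ⌈c⌉₊ + 2 * L := codeLength_le <|
    calc (pigeons c hc N : ℕ) ≤ ⌈c⌉₊ * (N : ℕ) ^ 2 := pigeons_le c hc N
      _ ≤ 2 ^ ⌈c⌉₊ * (2 ^ L) ^ 2 := by gcongr; exact Nat.lt_two_pow_self.le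
      _ = 2 ^ (⌈c⌉₊ + 2 * L) := by ring
  have hM : Nat.clog 2 (LossyCode M).bits ≤ 2 * ((L + 1) * (2 * k)) + 2 :=
    clog_bits_lossyCode_le M <|
      calc (M : ℕ) = (2 * (N : ℕ)) ^ (2 * k) := rfl
        _ ≤ (2 ^ (L + 1)) ^ (2 * k) := by gcongr
        _ = 2 ^ ((L + 1) * (2 * k)) := (pow_mul _ _ _).symm
  have hkL : k ≤ k * L := Nat.le_mul_of_pos_right k hL1
  have hkcL : k * ⌈c⌉₊ ≤ k * ⌈c⌉₊ * L := Nat.le_mul_of_pos_right _ hL1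
  calc Nat.clog 2 (LossyCode M).bits +
        k * (2 * codeLength (2 * N) + codeLength (pigeons c hc N) + 2)
      ≤ (2 * ((L + 1) * (2 * k)) + 2) + k * (2 * (L + 1) + (⌈c⌉₊ + 2 * L) + 2) := by gcongr
    _ = 8 * (k * L) + 8 * k + k * ⌈c⌉₊ + 2 := by ring
    _ ≤ 16 * (k * L) + k * ⌈c⌉₊ * L + 2 * L := by omega
    _ = (16 * k + k * ⌈c⌉₊ + 2) * L ^ 1 := by ring
    _ ≤ (16 * k + k * ⌈c⌉₊ + 2) * L ^ (16 * k + k * ⌈c⌉₊ + 2) := by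
      exact Nat.mul_le_mul_left _ (Nat.pow_le_pow_right hL1 (by omega))

/-- The colour bits alone suffice; this turns a bound polylogarithmic in `N` into one in the input
length. -/
theorem le_bits_amgmLossyCode (c : ℝ) (hc : 1 < c) (N : ℕ+) :
    (N : ℕ) ≤ (AMGMLossyCode c hc N).bits := by
  have h := Fintype.card_le_of_injective
    (fun v : Fin (2 * (N : ℕ)) => (Sum.inl v : (AMGMLossyCode c hc N).Idx)) Sum.inl_injective
  rw [Fintype.card_fin] at h
  exact (Nat.le_mul_of_pos_left _ two_pos).trans h

theorem mainTheorem10 (c : ℝ) (hc : 1 < c) :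
    SearchProblem.DTReducible (AMGMLossyCode c hc) LossyCode ∧
    ∃ K : ℕ, ∀ N : ℕ+, SearchProblem.ReductionComplexityLE (AMGMLossyCode c hc N) LossyCode
      (K * (Nat.log 2 (N : ℕ) + 1) ^ K) := by
  have h := amgmLossyCode_reductionComplexityLE c hc
  refine ⟨?_, h⟩
  obtain ⟨K, hK⟩ := h
  refine ⟨K, fun N => ?_⟩
  obtain ⟨M, φ, d, hd, hb⟩ := hK N
  have hlog : Nat.log 2 (N : ℕ) ≤ Nat.log 2 (AMGMLossyCode c hc N).bits :=
    Nat.log_mono_right (le_bits_amgmLossyCode c hc N)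
  exact ⟨M, φ, d, hd, hb.trans (by gcongr)⟩
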